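/- Let $d\ge 1$ and let $Y_0,Y_1,Y_2,\dots$ be i.i.d. $\mathbb{R}^d$-valued random variables with zero mean, identity covariance matrix and $E[|Y_0|^k]<\infty$ for all $k\in\mathbb{N}$. Assume that there are $\alpha>0$ and a constant $C_\sharp$ such that the characteristic function $\phi(u)=E[e^{i\langle u,Y_0\rangle}]$ satisfies $|\phi(u)|\le C_\sharp(1+|u|)^{-\alpha}$ for all $u\in\mathbb{R}^d$, where $|\cdot|$ is the Euclidean norm. Put $S_n:=n^{-1/2}\sum_{j=1}^n Y_j$, let $\Phi$ have the standard Gaussian law on $\mathbb{R}^d$, and let $d_{TV}(X,Z):=\sup_{|g|\le 1}|E[g(X)]-E[g(Z)]|$, the supremum being over measurable $g:\mathbb{R}^d\to\mathbb{R}$ with absolute value at most one. Then for each $\epsilon>0$ there is a constant $C_\epsilon$ such that $$d_{TV}(S_n,\Phi)\le C_\epsilon\, n^{-\frac12+\epsilon}\quad\text{for all } n\ge 2.$$ Moreover, for every $n$ with $n>d/\alpha$ the law of $S_n$ has a continuous density $f_{S_n}$ with respect to Lebesgue measure, and for each $\epsilon>0$ there is a constant $C'_\epsilon$ such that $$\sup_{x\in\mathbb{R}^d}|f_{S_n}(x)-f_\Phi(x)|\le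 C'_\epsilon\, n^{-\frac12+\epsilon}\quad\text{for all } n>d/\alpha,$$ where $f_\Phi(x)=(2\pi)^{-d/2}e^{-|x|^2/2}$. -/

import Mathlib

open MeasureTheory ProbabilityTheory
open scoped ENNReal

/-- Total variation distance: the supremum of `|∫ f dμ - ∫ f dν|` over all measurable `f` with
`|f| ≤ 1`, taken in `ℝ≥0∞`. With this normalization it is at most `2` on probability measures. -/
noncomputable def tvDist {E : Type*} [MeasurableSpace E] (μ ν : Measure E) : ℝ≥0∞ :=
  ⨆ (f : E → ℝ) (_ : Measurable f) (_ : ∀ x, |f x| ≤ 1),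
    ENNReal.ofReal |∫ x, f x ∂μ - ∫ x, f x ∂ν|

/-- The normalized sum `S_n = (Y_1 + ⋯ + Y_n) / √n`. -/
noncomputable def normalizedSum {Ω : Type*} {d : ℕ} (Y : ℕ → Ω → EuclideanSpace ℝ (Fin d))
    (n : ℕ) (ω : Ω) : EuclideanSpace ℝ (Fin d) :=
  (√(n : ℝ))⁻¹ • ∑ j ∈ Finset.Icc 1 n, Y j ω

/-- The standard Gaussian density `(2π)^(-d/2) exp(-|x|²/2)` on `ℝ^d`. -/
noncomputable def stdGaussianDensity {d : ℕ} (x : EuclideanSpace ℝ (Fin d)) : ℝ :=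
  (2 * Real.pi) ^ (-(d : ℝ) / 2) * Real.exp (-‖x‖ ^ 2 / 2)

/-- `f` is a continuous probability density, with respect to Lebesgue measure, of `μ`.
Such an `f` is unique if it exists. -/
structure IsContinuousDensity {d : ℕ} (f : EuclideanSpace ℝ (Fin d) → ℝ)
    (μ : Measure (EuclideanSpace ℝ (Fin d))) : Prop where
  continuous : Continuous f
  nonneg : ∀ x, 0 ≤ f x
  eq_withDensity : μ = volume.withDensity (fun x => ENNReal.ofReal (f x))

/-! ### Fourier inversion for finite measures with integrable characteristic function. -/

section Inversion

open Filter Topology Complex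
open scoped Real FourierTransform RealInnerProductSpace

variable {V : Type*} [NormedAddCommGroup V] [InnerProductSpace ℝ V] [FiniteDimensional ℝ V]
  [MeasurableSpace V] [BorelSpace V]

/-! Both bounds reduce to one L¹ estimate: with `φ` the characteristic function of `Y 0`, the
integral of `|φ(u/√n)^n - exp(-|u|²/2)|` is `O(n^(-1/2))`
(`exists_integral_norm_charFun_pow_sub_le`). By Fourier inversion (`eq_withDensity_fourierDensity`,
`abs_fourierDensity_sub_le`) it bounds the densities' difference uniformly, with no loss of `ε`.

For the L¹ estimate, put `t = u/√n`. Near the origin a third-order Taylor expansion shows that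
`φ(t)` and `exp(-|t|²/2)` differ by `O(|t|³)` and are both at most `exp(-|t|²/4)`; taking `n`-th
powers gives an error `n^(-1/2)` times an integrable Gaussian. Away from the origin polynomial decay
yields `|φ| ≤ q < 1` (`exists_norm_charFun_le_of_decay`). A fixed number `m > d/α` of factors keeps
the integral finite, and the remaining `q^(n-m)` beats every power of `n`.

For total variation, the uniform bound is integrated over a ball of radius `R = n^(ε/d)`, which
costs the factor `R^d = n^ε`. Outside the ball Markov's inequality applies with a high moment,
bounded uniformly in `n` by `exists_integral_norm_normalizedSum_pow_le`. -/

/-- The density obtained from the characteristic function by Fourier inversion. -/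
noncomputable def fourierDensity (μ : Measure V) (x : V) : ℝ :=
  (𝓕 (fun u : V => charFun μ ((2 * π) • u)) x).re

/-- The density of the convolution of `μ` with a centred Gaussian law of precision `2π²c`. -/
noncomputable def gaussianMollification (μ : Measure V) (c : ℝ) (x : V) : ℝ :=
  ∫ y, (π * c) ^ (Module.finrank ℝ V / 2 : ℝ) * rexp (-(π ^ 2 * c) * ‖y - x‖ ^ 2) ∂μ

lemma integrable_rexp_neg_mul_sq_norm {b : ℝ} (hb : 0 < b) :
    Integrable (fun u : V => rexp (-b * ‖u‖ ^ 2)) := by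
  have := (GaussianFourier.integrable_cexp_neg_mul_sq_norm_add (V := V)
    (b := (b : ℂ)) (by simpa using hb) 0 0).norm
  refine this.congr (ae_of_all _ fun u => ?_)
  simp only [Complex.norm_exp]
  norm_cast
  simp

/-- By Fubini, the inner integral over `u` is the Fourier transform of a Gaussian. Damping the
inversion integral thus amounts to smoothing `μ` by a positive kernel, which is how positivity
reaches the limit density. -/
lemma integral_gaussian_mul_charFun (μ : Measure V) [IsFiniteMeasure μ] {c : ℝ} (hc : 0 < c)
    (x : V) :
    ∫ u : V, cexp (-c⁻¹ * ‖u‖ ^ 2) •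
        (𝐞 (-⟪u, x⟫) • charFun μ ((2 * π) • u)) = (gaussianMollification μ c x : ℂ) := by
  have h1 : ∀ u : V, cexp (-c⁻¹ * ‖u‖ ^ 2) • (𝐞 (-⟪u, x⟫) • charFun μ ((2 * π) • u)) =
      ∫ y, (𝐞 (-⟪u, x⟫) • cexp (-(c⁻¹ : ℝ) * ‖u‖ ^ 2 + 2 * π * Complex.I * ⟪y, u⟫)) ∂μ := by
    intro u
    simp_rw [Circle.smul_def, smul_eq_mul, charFun_apply, ← integral_const_mul]
    congr 1
    ext y
    rw [Complex.exp_add, inner_smul_right]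
    push_cast
    rw [show (2 * π * ⟪y, u⟫ * I : ℂ) = 2 * π * I * ⟪y, u⟫ by ring]
    ring
  simp_rw [h1]
  rw [integral_integral_swap]
  · have h2 : ∀ y : V, ∫ u : V, 𝐞 (-⟪u, x⟫) •
        cexp (-(c⁻¹ : ℝ) * ‖u‖ ^ 2 + 2 * π * Complex.I * ⟪y, u⟫) =
        (((π * c) ^ (Module.finrank ℝ V / 2 : ℝ) * rexp (-(π ^ 2 * c) * ‖y - x‖ ^ 2) : ℝ) : ℂ) := by
      intro y
      have := fourier_gaussian_innerProductSpace' (b := ((c⁻¹ : ℝ) : ℂ))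
        (by simpa using hc) y x
      rw [Real.fourier_eq] at this
      rw [this]
      push_cast
      rw [Complex.ofReal_cpow (by positivity)]
      push_cast
      congr 2
      · rw [div_inv_eq_mul]
      · rw [div_inv_eq_mul]; ring
    simp_rw [h2]
    rw [integral_complex_ofReal]
    rfl
  · have hg : Integrable (fun u : V => rexp (-c⁻¹ * ‖u‖ ^ 2)) :=
      integrable_rexp_neg_mul_sq_norm (inv_pos.2 hc)
    refine (hg.mul_prod (integrable_const (μ := μ) (1 : ℝ))).mono' ?_ (ae_of_all _ fun p => ?_)
    · refine Continuous.aestronglyMeasurable ?_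
      simp only [Circle.smul_def]
      fun_prop
    · simp only [Function.uncurry, Circle.norm_smul, Complex.norm_exp]
      simp
      norm_cast

lemma lintegral_gaussianMollification_le (μ : Measure V) [IsFiniteMeasure μ] {c : ℝ} (hc : 0 < c) :
    ∫⁻ x, ENNReal.ofReal (gaussianMollification μ c x) ≤ μ Set.univ := by
  have h1 : ∀ x, ENNReal.ofReal (gaussianMollification μ c x) ≤ ∫⁻ y, ENNReal.ofReal
      ((π * c) ^ (Module.finrank ℝ V / 2 : ℝ) * rexp (-(π ^ 2 * c) * ‖y - x‖ ^ 2)) ∂μ := by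
    intro x
    refine ENNReal.ofReal_le_of_le_toReal ?_
    rw [gaussianMollification, integral_eq_lintegral_of_nonneg_ae]
    · exact ae_of_all _ fun _ => by positivity
    · exact (by fun_prop : Continuous _).aestronglyMeasurable
  refine (lintegral_mono h1).trans ?_
  rw [lintegral_lintegral_swap]
  · have h2 : ∀ y : V, ∫⁻ x, ENNReal.ofReal
      ((π * c) ^ (Module.finrank ℝ V / 2 : ℝ) * rexp (-(π ^ 2 * c) * ‖y - x‖ ^ 2)) = 1 := by
      intro y
      rw [lintegral_sub_left_eq_self (fun z : V => ENNReal.ofReal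
        ((π * c) ^ (Module.finrank ℝ V / 2 : ℝ) * rexp (-(π ^ 2 * c) * ‖z‖ ^ 2))) y]
      rw [← ofReal_integral_eq_lintegral_ofReal
        ((integrable_rexp_neg_mul_sq_norm (by positivity)).const_mul _)
        (ae_of_all _ fun _ => by positivity), integral_const_mul,
        GaussianFourier.integral_rexp_neg_mul_sq_norm (by positivity),
        ← Real.mul_rpow (by positivity) (by positivity)]
      rw [show π * c * (π / (π ^ 2 * c)) = 1 by field_simp]
      simp
    simp_rw [h2]
    simp
  · refine Measurable.aemeasurable ?_
    simp only [Function.uncurry_def]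
    fun_prop

variable {μ : Measure V}

lemma integrable_comp_two_pi_smul {E : Type*} [NormedAddCommGroup E] {g : V → E}
    (hg : Integrable g) :
    Integrable (fun u : V => g ((2 * π) • u)) :=
  (integrable_comp_smul_iff volume g (by positivity)).2 hg

/-- As `c → ∞` the damping factor `exp(-|u|²/c)` tends to one, and integrability of the
characteristic function lets the limit pass under the integral. -/
lemma tendsto_gaussianMollification [IsFiniteMeasure μ] (hμ : Integrable (charFun μ)) (x : V) :
    Tendsto (fun c : ℝ => (gaussianMollification μ c x : ℂ)) atTop
      (𝓝 (𝓕 (fun u : V => charFun μ ((2 * π) • u)) x)) := by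
  have h := Real.tendsto_integral_cexp_sq_smul
    ((Real.fourierIntegral_convergent_iff (V := V) (f := fun u : V => charFun μ ((2 * π) • u)) x).2
      (integrable_comp_two_pi_smul hμ))
  rw [Real.fourier_eq]
  refine h.congr' ?_
  filter_upwards [eventually_gt_atTop 0] with c hc
  simpa using integral_gaussian_mul_charFun μ hc x

lemma tendsto_gaussianMollification_fourierDensity [IsFiniteMeasure μ]
    (hμ : Integrable (charFun μ)) (x : V) :
    Tendsto (fun c : ℝ => gaussianMollification μ c x) atTop (𝓝 (fourierDensity μ x)) := by
  exact (Complex.continuous_re.tendsto _).comp (tendsto_gaussianMollification hμ x)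

/-- A limit of real mollifications is real, so taking the real part in `fourierDensity` loses
nothing. -/
lemma ofReal_fourierDensity [IsFiniteMeasure μ] (hμ : Integrable (charFun μ)) (x : V) :
    (fourierDensity μ x : ℂ) = 𝓕 (fun u : V => charFun μ ((2 * π) • u)) x :=
  tendsto_nhds_unique
    ((Complex.continuous_ofReal.tendsto _).comp (tendsto_gaussianMollification_fourierDensity hμ x))
    (tendsto_gaussianMollification hμ x)

lemma fourierDensity_nonneg [IsFiniteMeasure μ] (hμ : Integrable (charFun μ)) (x : V) :
    0 ≤ fourierDensity μ x := by
  refine ge_of_tendsto (tendsto_gaussianMollification_fourierDensity hμ x) ?_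
  filter_upwards [eventually_gt_atTop 0] with c hc
  exact integral_nonneg fun _ => by positivity

lemma continuous_fourierDensity (hμ : Integrable (charFun μ)) : Continuous (fourierDensity μ) :=
  Complex.continuous_re.comp (VectorFourier.fourierIntegral_continuous Real.continuous_fourierChar
    continuous_inner (integrable_comp_two_pi_smul hμ))

lemma measurable_gaussianMollification [IsFiniteMeasure μ] (c : ℝ) :
    Measurable (gaussianMollification μ c) := by
  refine StronglyMeasurable.measurable (StronglyMeasurable.integral_prod_right ?_)
  exact Continuous.stronglyMeasurable (by fun_prop)

/-- Fatou's lemma: the mollifications are nonnegative, converge pointwise and have mass at most that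
of `μ`. Integrability is what the L¹ inversion theorem requires next. -/
lemma integrable_fourierDensity [IsFiniteMeasure μ] (hμ : Integrable (charFun μ)) :
    Integrable (fourierDensity μ) := by
  refine ⟨(continuous_fourierDensity hμ).aestronglyMeasurable, ?_⟩
  rw [hasFiniteIntegral_iff_ofReal (ae_of_all _ (fourierDensity_nonneg hμ))]
  have h : ∀ x, ENNReal.ofReal (fourierDensity μ x) = liminf (fun n : ℕ =>
      ENNReal.ofReal (gaussianMollification μ ((n : ℝ) + 1) x)) atTop := fun x =>
    (((ENNReal.continuous_ofReal.tendsto _).comp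
      ((tendsto_gaussianMollification_fourierDensity hμ x).comp
        (tendsto_natCast_atTop_atTop.atTop_add tendsto_const_nhds))).liminf_eq).symm
  simp_rw [h]
  refine (lintegral_liminf_le fun n =>
    (measurable_gaussianMollification _).ennreal_ofReal).trans_lt ?_
  refine lt_of_le_of_lt ?_ (measure_lt_top μ Set.univ)
  refine liminf_le_of_le (by isBoundedDefault) fun b hb => ?_
  obtain ⟨n, hn⟩ := hb.exists
  exact hn.trans (lintegral_gaussianMollification_le μ (by positivity))

/-- **Inversion formula**: a finite measure with integrable characteristic function has the
continuous density `fourierDensity`. -/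
theorem eq_withDensity_fourierDensity [IsFiniteMeasure μ] (hμ : Integrable (charFun μ)) :
    μ = volume.withDensity (fun x => ENNReal.ofReal (fourierDensity μ x)) := by
  have hint := integrable_fourierDensity hμ
  have : IsFiniteMeasure (volume.withDensity (fun x => ENNReal.ofReal (fourierDensity μ x))) :=
    isFiniteMeasure_withDensity_ofReal hint.2
  have hF : 𝓕 (fun u : V => charFun μ ((2 * π) • u)) = fun x => (fourierDensity μ x : ℂ) :=
    funext fun x => (ofReal_fourierDensity hμ x).symm
  refine Measure.ext_of_charFun (funext fun t => ?_)
  have hinv := Continuous.fourierInv_fourier_eq (f := fun u : V => charFun μ ((2 * π) • u))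
    (by have := continuous_charFun (μ := μ); fun_prop) (integrable_comp_two_pi_smul hμ)
    (by rw [hF]; exact hint.ofReal)
  -- The evaluation point undoes the rescaling by `2π` between `charFun` and `𝓕`; the inverse
  -- transform then reads as the characteristic function of the candidate density.
  have h1 := congrFun hinv ((2 * π)⁻¹ • t)
  beta_reduce at h1
  rw [smul_inv_smul₀ (by positivity)] at h1
  rw [← h1, hF, Real.fourierInv_eq', charFun_apply, integral_withDensity_eq_integral_toReal_smul
    (continuous_fourierDensity hμ).measurable.ennreal_ofReal (ae_of_all _ fun _ => by simp)]
  congr 1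
  ext x
  rw [ENNReal.toReal_ofReal (fourierDensity_nonneg hμ x), inner_smul_right, Complex.real_smul,
    smul_eq_mul, mul_comm]
  congr 3
  push_cast
  field_simp

lemma abs_fourierDensity_sub_le {ν : Measure V} (hμ : Integrable (charFun μ))
    (hν : Integrable (charFun ν)) (x : V) :
    |fourierDensity μ x - fourierDensity ν x| ≤
      ∫ u : V, ‖charFun μ ((2 * π) • u) - charFun ν ((2 * π) • u)‖ := by
  rw [fourierDensity, fourierDensity, ← Complex.sub_re]
  refine (Complex.abs_re_le_norm _).trans ?_
  rw [Real.fourier_eq, Real.fourier_eq, ← integral_sub]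
  · refine (norm_integral_le_integral_norm _).trans_eq ?_
    simp_rw [← smul_sub, Circle.norm_smul]
  · exact (Real.fourierIntegral_convergent_iff x).2 (integrable_comp_two_pi_smul hμ)
  · exact (Real.fourierIntegral_convergent_iff x).2 (integrable_comp_two_pi_smul hν)

lemma integrable_charFun_stdGaussian : Integrable (charFun (stdGaussian V)) := by
  have h := (integrable_rexp_neg_mul_sq_norm (V := V) (b := 1 / 2) (by norm_num)).ofReal (𝕜 := ℂ)
  refine h.congr (ae_of_all _ fun u => ?_)
  rw [charFun_stdGaussian]
  simp only [RCLike.ofReal_eq_complex_ofReal]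
  push_cast
  ring_nf

end Inversion

lemma fourierDensity_stdGaussian {d : ℕ} (x : EuclideanSpace ℝ (Fin d)) :
    fourierDensity (stdGaussian (EuclideanSpace ℝ (Fin d))) x = stdGaussianDensity x := by
  have h := fourier_gaussian_innerProductSpace (V := EuclideanSpace ℝ (Fin d))
    (b := ((2 * Real.pi ^ 2 : ℝ) : ℂ)) (by rw [Complex.ofReal_re]; positivity) x
  have h2 : (fun u : EuclideanSpace ℝ (Fin d) =>
      charFun (stdGaussian (EuclideanSpace ℝ (Fin d))) ((2 * Real.pi) • u)) =
      fun v => Complex.exp (-((2 * Real.pi ^ 2 : ℝ) : ℂ) * ‖v‖ ^ 2) := by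
    ext u
    rw [charFun_stdGaussian, norm_smul, Real.norm_of_nonneg (by positivity)]
    push_cast
    ring_nf
  rw [fourierDensity, h2, h, stdGaussianDensity]
  have h3 : ((Real.pi : ℂ) / ((2 * Real.pi ^ 2 : ℝ) : ℂ)) ^
      (Module.finrank ℝ (EuclideanSpace ℝ (Fin d)) / 2 : ℂ) *
      Complex.exp (-(Real.pi : ℂ) ^ 2 * (‖x‖ : ℂ) ^ 2 / ((2 * Real.pi ^ 2 : ℝ) : ℂ)) =
      (((2 * Real.pi) ^ (-(d : ℝ) / 2) * Real.exp (-‖x‖ ^ 2 / 2) : ℝ) : ℂ) := by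
    rw [← Complex.ofReal_div]
    have e : Real.pi / (2 * Real.pi ^ 2) = (2 * Real.pi)⁻¹ := by field_simp
    rw [e]
    push_cast
    congr 1
    · rw [neg_div, Real.rpow_neg (by positivity), ← Real.inv_rpow (by positivity),
        Complex.ofReal_cpow (by positivity)]
      simp
    · congr 1
      have : (Real.pi : ℂ) ≠ 0 := by exact_mod_cast Real.pi_ne_zero
      field_simp
  rw [h3, Complex.ofReal_re]

/-! ### Characteristic function estimates and their L¹ convergence. -/

section CharFunEstimates

open Complex
open scoped RealInnerProductSpace

lemma norm_cexp_mul_I_sub_taylor_le (s : ℝ) :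
    ‖cexp (s * I) - (1 + s * I - s ^ 2 / 2)‖ ≤ 4 * |s| ^ 3 := by
  rcases le_or_gt |s| 1 with h | h
  · have h1 := Complex.norm_exp_sub_sum_le_norm_mul_exp (s * I) 3
    have h2 : ∑ m ∈ Finset.range 3, (s * I : ℂ) ^ m / m.factorial = 1 + s * I - s ^ 2 / 2 := by
      simp [Finset.sum_range_succ, mul_pow, Nat.factorial]
      ring
    rw [h2] at h1
    refine h1.trans ?_
    have h3 : ‖(s * I : ℂ)‖ = |s| := by simp
    rw [h3, mul_comm]
    have h4 : Real.exp |s| ≤ 4 :=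
      (Real.exp_le_exp.2 h).trans (Real.exp_one_lt_d9.le.trans (by norm_num))
    gcongr
  · have h1 : ‖cexp (s * I) - (1 + s * I - s ^ 2 / 2)‖ ≤ 1 + (1 + |s| + |s| ^ 2 / 2) := by
      refine (norm_sub_le _ _).trans (add_le_add (Complex.norm_exp_ofReal_mul_I s).le ?_)
      refine (norm_sub_le _ _).trans (add_le_add ((norm_add_le _ _).trans ?_) ?_) <;> simp
    have h2 : |s| ≤ |s| ^ 3 := by nlinarith [sq_nonneg |s|, mul_self_nonneg (|s| - 1)]
    have h3 : |s| ^ 2 ≤ |s| ^ 3 := pow_le_pow_right₀ h.le (by norm_num)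
    linarith

lemma norm_pow_sub_pow_le_of_norm_le {a b : ℂ} {ρ : ℝ} (ha : ‖a‖ ≤ ρ) (hb : ‖b‖ ≤ ρ) (n : ℕ) :
    ‖a ^ n - b ^ n‖ ≤ n * ρ ^ (n - 1) * ‖a - b‖ := by
  have hρ : 0 ≤ ρ := (norm_nonneg a).trans ha
  rw [← (Commute.all a b).geom_sum₂_mul, norm_mul]
  gcongr
  refine (norm_sum_le _ _).trans ?_
  have : ∀ i ∈ Finset.range n, ‖a ^ i * b ^ (n - 1 - i)‖ ≤ ρ ^ (n - 1) := by
    intro i hi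
    rw [norm_mul, norm_pow, norm_pow]
    calc ‖a‖ ^ i * ‖b‖ ^ (n - 1 - i) ≤ ρ ^ i * ρ ^ (n - 1 - i) := by gcongr
      _ = ρ ^ (n - 1) := by
        rw [← pow_add]; congr 1; have := Finset.mem_range.1 hi; omega
  simpa using Finset.sum_le_sum this

variable {V : Type*} [NormedAddCommGroup V] [InnerProductSpace ℝ V] [FiniteDimensional ℝ V]
  [MeasurableSpace V] [BorelSpace V] {μ : Measure V} [IsProbabilityMeasure μ]

lemma integrable_norm_pow_mono {k l : ℕ} (hkl : k ≤ l) (h : Integrable (fun x => ‖x‖ ^ l) μ) :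
    Integrable (fun x => ‖x‖ ^ k) μ := by
  refine ((integrable_const (1 : ℝ)).add h).mono' (by fun_prop) (ae_of_all _ fun x => ?_)
  rw [Real.norm_of_nonneg (by positivity), Pi.add_apply]
  rcases le_total ‖x‖ 1 with hx | hx
  · have := pow_le_one₀ (n := k) (norm_nonneg x) hx
    have : 0 ≤ ‖x‖ ^ l := by positivity
    linarith
  · have := pow_le_pow_right₀ hx hkl
    linarith

lemma norm_charFun_sub_taylor_le (h3 : Integrable (fun x => ‖x‖ ^ 3) μ)
    (hmean : ∀ t : V, ∫ x, ⟪x, t⟫ ∂μ = 0) (hcov : ∀ t : V, ∫ x, ⟪x, t⟫ ^ 2 ∂μ = ‖t‖ ^ 2)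
    (t : V) :
    ‖charFun μ t - (1 - ‖t‖ ^ 2 / 2)‖ ≤ 4 * (∫ x, ‖x‖ ^ 3 ∂μ) * ‖t‖ ^ 3 := by
  have i1 : Integrable (fun x : V => ⟪x, t⟫) μ := by
    refine ((integrable_norm_pow_mono (by norm_num : 1 ≤ 3) h3).mul_const ‖t‖).mono'
      (by fun_prop) (ae_of_all _ fun x => ?_)
    simpa using abs_real_inner_le_norm x t
  have i2 : Integrable (fun x : V => ⟪x, t⟫ ^ 2) μ := by
    refine ((integrable_norm_pow_mono (by norm_num : 2 ≤ 3) h3).mul_const (‖t‖ ^ 2)).mono'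
      (by fun_prop) (ae_of_all _ fun x => ?_)
    rw [norm_pow, ← mul_pow]
    gcongr
    exact abs_real_inner_le_norm x t
  have iexp : Integrable (fun x : V => cexp (⟪x, t⟫ * I)) μ := by
    refine (integrable_const (1 : ℝ)).mono' (by fun_prop) (ae_of_all _ fun x => ?_)
    rw [Complex.norm_exp_ofReal_mul_I]
  have e : charFun μ t - (1 - ‖t‖ ^ 2 / 2) =
      ∫ x, (cexp (⟪x, t⟫ * I) - (1 + ⟪x, t⟫ * I - (⟪x, t⟫ : ℂ) ^ 2 / 2)) ∂μ := by
    have j0 : Integrable (fun x : V => (⟪x, t⟫ : ℂ) * I) μ := i1.ofReal.mul_const I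
    have j1 : Integrable (fun x : V => (1 + (⟪x, t⟫ : ℂ) * I)) μ := (integrable_const _).add j0
    have j2 : Integrable (fun x : V => (⟪x, t⟫ : ℂ) ^ 2 / 2) μ := by
      simpa using (i2.ofReal (𝕜 := ℂ)).div_const 2
    have j3 : Integrable (fun x : V => 1 + (⟪x, t⟫ : ℂ) * I - (⟪x, t⟫ : ℂ) ^ 2 / 2) μ := j1.sub j2
    rw [integral_sub iexp j3, integral_sub j1 j2,
      integral_add (integrable_const _) j0, charFun_apply, integral_mul_const,
      integral_div, integral_complex_ofReal, hmean]
    have : ∫ x, (⟪x, t⟫ : ℂ) ^ 2 ∂μ = ((∫ x, ⟪x, t⟫ ^ 2 ∂μ : ℝ) : ℂ) := by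
      rw [← integral_complex_ofReal]; simp
    rw [this, hcov]
    simp
  rw [e]
  refine (norm_integral_le_of_norm_le (h3.const_mul (4 * ‖t‖ ^ 3))
    (ae_of_all _ fun x => ?_)).trans_eq ?_
  · refine (norm_cexp_mul_I_sub_taylor_le _).trans ?_
    calc 4 * |⟪x, t⟫| ^ 3 ≤ 4 * (‖x‖ * ‖t‖) ^ 3 := by
          gcongr; exact abs_real_inner_le_norm x t
      _ = _ := by ring
  · rw [integral_const_mul]; ring

/-- The radius is chosen so that the cubic Taylor error consumes at most half of the quadratic term,
leaving `1 - |t|²/4`. In `K`, the part `4M` is the Taylor error of `charFun μ` and the `1` is that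
of the Gaussian. -/
lemma exists_charFun_bounds_near_zero (h3 : Integrable (fun x => ‖x‖ ^ 3) μ)
    (hmean : ∀ t : V, ∫ x, ⟪x, t⟫ ∂μ = 0) (hcov : ∀ t : V, ∫ x, ⟪x, t⟫ ^ 2 ∂μ = ‖t‖ ^ 2) :
    ∃ r > 0, ∃ K ≥ 0, ∀ t : V, ‖t‖ ≤ r → ‖charFun μ t‖ ≤ Real.exp (-‖t‖ ^ 2 / 4) ∧
      ‖charFun μ t - Real.exp (-‖t‖ ^ 2 / 2)‖ ≤ K * ‖t‖ ^ 3 := by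
  set M := ∫ x, ‖x‖ ^ 3 ∂μ
  have hM : 0 ≤ M := integral_nonneg fun _ => by positivity
  refine ⟨1 / (16 * (M + 1)), by positivity, 4 * M + 1, by positivity, fun t ht => ?_⟩
  have ht1 : ‖t‖ ≤ 1 := ht.trans (by rw [div_le_one (by positivity)]; linarith)
  have htM : 16 * M * ‖t‖ ≤ 1 := by
    rw [le_div_iff₀ (by positivity)] at ht
    nlinarith [norm_nonneg t]
  have hT := norm_charFun_sub_taylor_le h3 hmean hcov t
  have h0 := norm_nonneg t
  have hsq : ‖t‖ ^ 2 ≤ 1 := pow_le_one₀ h0 ht1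
  constructor
  · have h1 : ‖charFun μ t‖ ≤ (1 - ‖t‖ ^ 2 / 2) + 4 * M * ‖t‖ ^ 3 := by
      have e : ‖(1 - (‖t‖ : ℂ) ^ 2 / 2)‖ = 1 - ‖t‖ ^ 2 / 2 := by
        rw [show (1 - (‖t‖ : ℂ) ^ 2 / 2) = ((1 - ‖t‖ ^ 2 / 2 : ℝ) : ℂ) by push_cast; ring,
          Complex.norm_real, Real.norm_of_nonneg (by linarith)]
      have := norm_sub_norm_le (charFun μ t) (1 - (‖t‖ : ℂ) ^ 2 / 2)
      rw [e] at this
      linarith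
    have h2 : 4 * M * ‖t‖ ^ 3 ≤ ‖t‖ ^ 2 / 4 := by
      have := mul_le_mul_of_nonneg_right htM (sq_nonneg ‖t‖)
      nlinarith
    have h3 := Real.add_one_le_exp (-‖t‖ ^ 2 / 4)
    linarith
  · have h1 : |Real.exp (-‖t‖ ^ 2 / 2) - 1 - (-‖t‖ ^ 2 / 2)| ≤ (-‖t‖ ^ 2 / 2) ^ 2 :=
      Real.abs_exp_sub_one_sub_id_le (by
        rw [abs_le]; constructor <;> linarith [sq_nonneg ‖t‖])
    have h2 : (-‖t‖ ^ 2 / 2) ^ 2 ≤ ‖t‖ ^ 3 := by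
      have : ‖t‖ ^ 4 ≤ ‖t‖ ^ 3 := pow_le_pow_of_le_one h0 ht1 (by norm_num)
      have : 0 ≤ ‖t‖ ^ 3 := by positivity
      nlinarith
    have e : charFun μ t - (Real.exp (-‖t‖ ^ 2 / 2) : ℝ) = (charFun μ t - (1 - ‖t‖ ^ 2 / 2)) -
        ((Real.exp (-‖t‖ ^ 2 / 2) - 1 - (-‖t‖ ^ 2 / 2) : ℝ) : ℂ) := by
      push_cast; ring
    rw [e]
    refine (norm_sub_le _ _).trans ?_
    rw [Complex.norm_real, Real.norm_eq_abs]
    linarith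

/-- The doubling inequality for the modulus of a characteristic function. -/
lemma one_sub_norm_charFun_two_smul_sq_le (t : V) :
    1 - ‖charFun μ ((2 : ℝ) • t)‖ ^ 2 ≤ 4 * (1 - ‖charFun μ t‖ ^ 2) := by
  -- Symmetrization: `ν` is the law of the difference of two independent copies, so `|charFun μ|²`
  -- is the integral of a cosine against `ν`. The claim becomes `1 - cos 2θ ≤ 4(1 - cos θ)`.
  set ν := μ ∗ (μ.map ((-1 : ℝ) • ·))
  have : IsProbabilityMeasure (μ.map ((-1 : ℝ) • ·)) :=
    Measure.isProbabilityMeasure_map (by fun_prop)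
  have hν : ∀ s : V, charFun ν s = ((‖charFun μ s‖ ^ 2 : ℝ) : ℂ) := by
    intro s
    rw [charFun_conv, charFun_map_smul, neg_one_smul, charFun_neg, Complex.mul_conj,
      Complex.normSq_eq_norm_sq]
  have hi : ∀ s : V, Integrable (fun x : V => cexp (⟪x, s⟫ * I)) ν := by
    intro s
    refine (integrable_const (1 : ℝ)).mono' (by fun_prop) (ae_of_all _ fun x => ?_)
    rw [Complex.norm_exp_ofReal_mul_I]
  have hc : ∀ s : V, Integrable (fun x : V => Real.cos ⟪x, s⟫) ν := by
    intro s
    simpa [Complex.exp_ofReal_mul_I_re] using (hi s).re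
  have hre : ∀ s : V, 1 - ‖charFun μ s‖ ^ 2 = ∫ x, (1 - Real.cos ⟪x, s⟫) ∂ν := by
    intro s
    rw [integral_sub (integrable_const _) (hc s)]
    have h1 : ‖charFun μ s‖ ^ 2 = (charFun ν s).re := by rw [hν, Complex.ofReal_re]
    have h2 : (charFun ν s).re = ∫ x, Real.cos ⟪x, s⟫ ∂ν := by
      rw [charFun_apply, ← RCLike.re_eq_complex_re, ← integral_re (hi s)]
      simp [Complex.exp_ofReal_mul_I_re]
    rw [h1, h2]
    simp
  rw [hre, hre, ← integral_const_mul]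
  refine integral_mono ((integrable_const _).sub (hc _))
    (((integrable_const _).sub (hc _)).const_mul _) fun x => ?_
  simp only [inner_smul_right, Real.cos_two_mul]
  nlinarith [Real.cos_le_one ⟪x, t⟫, Real.neg_one_le_cos ⟪x, t⟫]

lemma one_sub_norm_charFun_two_pow_smul_sq_le (t : V) (k : ℕ) :
    1 - ‖charFun μ ((2 : ℝ) ^ k • t)‖ ^ 2 ≤ 4 ^ k * (1 - ‖charFun μ t‖ ^ 2) := by
  induction k with
  | zero => simp
  | succ k ih =>
    have := one_sub_norm_charFun_two_smul_sq_le (μ := μ) ((2 : ℝ) ^ k • t)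
    rw [smul_smul, ← pow_succ'] at this
    rw [pow_succ' (4 : ℝ)]
    linarith

/-- Doubling `k` times moves every `t` with `‖t‖ ≥ r` to where the decay forces modulus at most
`1/2`. The doubling inequality carries the gap `1 - 1/4` back to `t`, shrunk by `4^k`; hence the
explicit `q`. -/
lemma exists_norm_charFun_le_of_decay {α C : ℝ} (hα : 0 < α)
    (hdecay : ∀ t : V, ‖charFun μ t‖ ≤ C * (1 + ‖t‖) ^ (-α)) {r : ℝ} (hr : 0 < r) :
    ∃ q : ℝ, 0 < q ∧ q < 1 ∧ ∀ t : V, r ≤ ‖t‖ → ‖charFun μ t‖ ≤ q := by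
  have h1 : Filter.Tendsto (fun k : ℕ => C * (2 ^ k * r) ^ (-α)) Filter.atTop (nhds (C * 0)) := by
    refine Filter.Tendsto.const_mul _ ((tendsto_rpow_neg_atTop hα).comp ?_)
    exact (tendsto_pow_atTop_atTop_of_one_lt (by norm_num)).atTop_mul_const hr
  rw [mul_zero] at h1
  obtain ⟨k, hk⟩ := (h1.eventually_lt_const (by norm_num : (0 : ℝ) < 1 / 2)).exists
  have hC : 0 ≤ C := by simpa using (norm_nonneg _).trans (hdecay 0)
  refine ⟨√(1 - 3 / 4 / 4 ^ k), ?_, ?_, fun t ht => ?_⟩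
  · have : (1 : ℝ) ≤ 4 ^ k := one_le_pow₀ (by norm_num)
    have : (3 / 4 / 4 ^ k : ℝ) ≤ 3 / 4 := div_le_self (by norm_num) this
    exact Real.sqrt_pos.2 (by linarith)
  · rw [Real.sqrt_lt' one_pos]
    have : (0 : ℝ) < 3 / 4 / 4 ^ k := by positivity
    linarith
  · refine Real.le_sqrt_of_sq_le ?_
    have h2 := one_sub_norm_charFun_two_pow_smul_sq_le (μ := μ) t k
    have h3 : ‖charFun μ ((2 : ℝ) ^ k • t)‖ ≤ 1 / 2 := by
      refine (hdecay _).trans (le_trans ?_ hk.le)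
      refine mul_le_mul_of_nonneg_left ?_ hC
      refine Real.rpow_le_rpow_of_nonpos (by positivity) ?_ (by linarith)
      rw [norm_smul, Real.norm_of_nonneg (by positivity)]
      have : (2 : ℝ) ^ k * r ≤ 2 ^ k * ‖t‖ := by gcongr
      linarith
    have h4 : ‖charFun μ ((2 : ℝ) ^ k • t)‖ ^ 2 ≤ 1 / 4 := by
      nlinarith [norm_nonneg (charFun μ ((2 : ℝ) ^ k • t))]
    have h5 : (3 / 4 : ℝ) / 4 ^ k ≤ 1 - ‖charFun μ t‖ ^ 2 := by
      rw [div_le_iff₀ (by positivity)]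
      linarith
    linarith

lemma integrable_charFun_pow_of_decay {α C : ℝ}
    (hdecay : ∀ t : V, ‖charFun μ t‖ ≤ C * (1 + ‖t‖) ^ (-α)) {n : ℕ}
    (hn : (Module.finrank ℝ V : ℝ) < α * n) :
    Integrable (fun t : V => charFun μ t ^ n) := by
  refine ((integrable_one_add_norm (μ := volume) hn).const_mul (C ^ n)).mono'
    (by have := continuous_charFun (μ := μ); fun_prop) (ae_of_all _ fun t => ?_)
  rw [norm_pow]
  refine (pow_le_pow_left₀ (norm_nonneg _) (hdecay t) n).trans_eq ?_
  rw [mul_pow, ← Real.rpow_mul_natCast (by positivity), neg_mul]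

lemma one_add_pow_four_mul_exp_le (x : ℝ) :
    (1 + x ^ 4) * Real.exp (-x ^ 2 / 8) ≤ 513 * Real.exp (-(1 / 16) * x ^ 2) := by
  have h1 : (x ^ 2 / 16) ^ 2 / 2 ≤ Real.exp (x ^ 2 / 16) := by
    simpa using Real.pow_div_factorial_le_exp (x ^ 2 / 16) (by positivity) 2
  have h2 : 1 ≤ Real.exp (x ^ 2 / 16) := Real.one_le_exp (by positivity)
  have h3 : 1 + x ^ 4 ≤ 513 * Real.exp (x ^ 2 / 16) := by nlinarith
  calc (1 + x ^ 4) * Real.exp (-x ^ 2 / 8)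
      ≤ 513 * Real.exp (x ^ 2 / 16) * Real.exp (-x ^ 2 / 8) := by gcongr
    _ = _ := by rw [mul_assoc, ← Real.exp_add]; ring_nf

/-- The range splits at `‖u‖/√n = r`. The `m` factors left unestimated make the second term
integrable once `m` is large; bounding all of them by `q` would leave a constant. -/
lemma exists_norm_charFun_pow_sub_le (h3 : Integrable (fun x => ‖x‖ ^ 3) μ)
    (hmean : ∀ t : V, ∫ x, ⟪x, t⟫ ∂μ = 0) (hcov : ∀ t : V, ∫ x, ⟪x, t⟫ ^ 2 ∂μ = ‖t‖ ^ 2)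
    {α C : ℝ} (hα : 0 < α) (hdecay : ∀ t : V, ‖charFun μ t‖ ≤ C * (1 + ‖t‖) ^ (-α)) (m : ℕ) :
    ∃ A : ℝ, ∃ q : ℝ, 0 < q ∧ q < 1 ∧ ∀ n : ℕ, 2 ≤ n → m ≤ n → ∀ u : V,
      ‖charFun μ ((√n)⁻¹ • u) ^ n - Real.exp (-‖u‖ ^ 2 / 2)‖ ≤
        (√n)⁻¹ * (A * Real.exp (-(1 / 16) * ‖u‖ ^ 2)) +
          q ^ (n - m) * ‖charFun μ ((√n)⁻¹ • u) ^ m‖ := by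
  obtain ⟨r, hr, K, hK, hnear⟩ := exists_charFun_bounds_near_zero h3 hmean hcov
  obtain ⟨q, hq0, hq1, hq⟩ := exists_norm_charFun_le_of_decay hα hdecay hr
  -- `K` serves the near range and `r⁻¹` the Gaussian tail in the far range; `513 = 512 + 1` comes
  -- from absorbing `1 + ‖u‖⁴` into an exponential.
  refine ⟨(K + r⁻¹) * 513, q, hq0, hq1, fun n hn hmn u => ?_⟩
  have hn0 : (0 : ℝ) < n := by positivity
  have hs : 0 < √(n : ℝ) := Real.sqrt_pos.2 hn0
  have hss : √(n : ℝ) ^ 2 = n := Real.sq_sqrt hn0.le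
  set t := (√(n : ℝ))⁻¹ • u with ht
  have htn : ‖t‖ = (√(n : ℝ))⁻¹ * ‖u‖ := by
    rw [ht, norm_smul, Real.norm_of_nonneg (by positivity)]
  have htn2 : ‖t‖ ^ 2 * n = ‖u‖ ^ 2 := by
    rw [htn, mul_pow, inv_pow, hss]; field_simp
  have hpoly : (1 + ‖u‖ ^ 4) * Real.exp (-‖u‖ ^ 2 / 8) ≤ 513 * Real.exp (-(1 / 16) * ‖u‖ ^ 2) :=
    one_add_pow_four_mul_exp_le _
  have hu0 := norm_nonneg u
  rcases le_or_gt ‖t‖ r with htr | htr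
  · obtain ⟨h1, h2⟩ := hnear t htr
    have h4 : ‖((Real.exp (-‖t‖ ^ 2 / 2) : ℝ) : ℂ)‖ ≤ Real.exp (-‖t‖ ^ 2 / 4) := by
      rw [Complex.norm_real, Real.norm_of_nonneg (Real.exp_pos _).le]
      refine Real.exp_le_exp.2 ?_
      nlinarith [sq_nonneg ‖t‖]
    have h5 := norm_pow_sub_pow_le_of_norm_le h1 h4 n
    have h6 : (((Real.exp (-‖t‖ ^ 2 / 2) : ℝ) : ℂ)) ^ n = ((Real.exp (-‖u‖ ^ 2 / 2) : ℝ) : ℂ) := by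
      rw [← Complex.ofReal_pow, ← Real.exp_nat_mul, ← htn2]
      congr 2; ring
    rw [h6] at h5
    -- This uses `n - 1 ≥ n/2`, whence the requirement `2 ≤ n`.
    have h7 : Real.exp (-‖t‖ ^ 2 / 4) ^ (n - 1) ≤ Real.exp (-‖u‖ ^ 2 / 8) := by
      rw [← Real.exp_nat_mul, Real.exp_le_exp, ← htn2, Nat.cast_sub (by omega)]
      have : (2 : ℝ) ≤ n := by exact_mod_cast hn
      push_cast
      nlinarith [sq_nonneg ‖t‖]
    have h8 : (n : ℝ) * ‖t‖ ^ 3 = (√(n : ℝ))⁻¹ * ‖u‖ ^ 3 := by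
      rw [htn, mul_pow]
      nth_rewrite 1 [← hss]
      field_simp
    have h9 : ‖u‖ ^ 3 ≤ 1 + ‖u‖ ^ 4 := by
      nlinarith [sq_nonneg (‖u‖ ^ 2 - ‖u‖ / 2), sq_nonneg (‖u‖ ^ 2 - 1), sq_nonneg ‖u‖]
    calc _ ≤ n * Real.exp (-‖t‖ ^ 2 / 4) ^ (n - 1) * (K * ‖t‖ ^ 3) :=
          h5.trans (by gcongr)
      _ ≤ n * Real.exp (-‖u‖ ^ 2 / 8) * (K * ‖t‖ ^ 3) := by gcongr
      _ = K * (√(n : ℝ))⁻¹ * (‖u‖ ^ 3 * Real.exp (-‖u‖ ^ 2 / 8)) := by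
          linear_combination K * Real.exp (-‖u‖ ^ 2 / 8) * h8
      _ ≤ K * (√(n : ℝ))⁻¹ * ((1 + ‖u‖ ^ 4) * Real.exp (-‖u‖ ^ 2 / 8)) := by gcongr
      _ ≤ K * (√(n : ℝ))⁻¹ * (513 * Real.exp (-(1 / 16) * ‖u‖ ^ 2)) := by gcongr
      _ ≤ (K + r⁻¹) * (√(n : ℝ))⁻¹ * (513 * Real.exp (-(1 / 16) * ‖u‖ ^ 2)) := by
          gcongr; linarith [inv_pos.2 hr]
      _ = (√n)⁻¹ * ((K + r⁻¹) * 513 * Real.exp (-(1 / 16) * ‖u‖ ^ 2)) := by ring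
      _ ≤ _ := le_add_of_nonneg_right (by positivity)
  · rw [sub_eq_add_neg]
    refine (norm_add_le _ _).trans ?_
    rw [norm_neg, add_comm]
    refine add_le_add ?_ ?_
    · rw [Complex.norm_real, Real.norm_of_nonneg (Real.exp_pos _).le]
      -- In the far range this factor, at least one, supplies the `n^(-1/2)` in front of the
      -- Gaussian.
      have h1 : 1 ≤ (√n)⁻¹ * r⁻¹ * ‖u‖ := by
        rw [htn] at htr
        have := (div_le_div_of_nonneg_right htr.le hr.le)
        rw [div_self hr.ne'] at this
        refine this.trans_eq ?_
        field_simp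
      have h9 : ‖u‖ ≤ 1 + ‖u‖ ^ 4 := by nlinarith [sq_nonneg (‖u‖ - 1), sq_nonneg (‖u‖ ^ 2 - 1)]
      calc Real.exp (-‖u‖ ^ 2 / 2) ≤ ((√n)⁻¹ * r⁻¹ * ‖u‖) * Real.exp (-‖u‖ ^ 2 / 2) :=
            le_mul_of_one_le_left (Real.exp_pos _).le h1
        _ ≤ ((√n)⁻¹ * r⁻¹ * (1 + ‖u‖ ^ 4)) * Real.exp (-‖u‖ ^ 2 / 8) := by
            gcongr ?_ * Real.exp ?_
            · gcongr
            · nlinarith [sq_nonneg ‖u‖]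
        _ = ((√n)⁻¹ * r⁻¹) * ((1 + ‖u‖ ^ 4) * Real.exp (-‖u‖ ^ 2 / 8)) := by ring
        _ ≤ ((√n)⁻¹ * r⁻¹) * (513 * Real.exp (-(1 / 16) * ‖u‖ ^ 2)) := by gcongr
        _ ≤ ((√n)⁻¹ * (K + r⁻¹)) * (513 * Real.exp (-(1 / 16) * ‖u‖ ^ 2)) := by
            gcongr; linarith
        _ = _ := by ring
    · rw [norm_pow, norm_pow, ← Nat.sub_add_cancel hmn, pow_add, Nat.sub_add_cancel hmn]
      gcongr
      exact hq t htr.le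

lemma exists_forall_pow_mul_pow_le {q : ℝ} (hq0 : 0 < q) (hq1 : q < 1) (k : ℕ) :
    ∃ B : ℝ, ∀ n : ℕ, (n : ℝ) ^ k * q ^ n ≤ B := by
  obtain ⟨B, hB⟩ := (tendsto_pow_const_mul_const_pow_of_lt_one k hq0.le hq1).bddAbove_range
  exact ⟨B, fun n => hB ⟨n, rfl⟩⟩

/-- The characteristic functions of normalized sums converge in `L¹` at rate `n^(-1/2)`. -/
theorem exists_integral_norm_charFun_pow_sub_le (h3 : Integrable (fun x => ‖x‖ ^ 3) μ)
    (hmean : ∀ t : V, ∫ x, ⟪x, t⟫ ∂μ = 0) (hcov : ∀ t : V, ∫ x, ⟪x, t⟫ ^ 2 ∂μ = ‖t‖ ^ 2)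
    {α C : ℝ} (hα : 0 < α) (hdecay : ∀ t : V, ‖charFun μ t‖ ≤ C * (1 + ‖t‖) ^ (-α)) :
    ∃ D : ℝ, 0 ≤ D ∧ ∀ n : ℕ, 0 < n → (Module.finrank ℝ V : ℝ) < α * n →
      ∫ u : V, ‖charFun μ ((√n)⁻¹ • u) ^ n - Real.exp (-‖u‖ ^ 2 / 2)‖ ≤ D * (√n)⁻¹ := by
  set d := Module.finrank ℝ V
  obtain ⟨m, hm⟩ : ∃ m : ℕ, (d : ℝ) < α * m := by
    obtain ⟨m, hm⟩ := exists_nat_gt ((d : ℝ) / α)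
    exact ⟨m, by rwa [div_lt_iff₀' hα] at hm⟩
  obtain ⟨A, q, hq0, hq1, hbound⟩ := exists_norm_charFun_pow_sub_le h3 hmean hcov hα hdecay m
  -- Rescaling `u` by `√n` produces `√n^d ≤ n^(d+1)/√n`, so the power `d + 1` is enough.
  obtain ⟨B, hB⟩ := exists_forall_pow_mul_pow_le hq0 hq1 (d + 1)
  set G := ∫ u : V, Real.exp (-(1 / 16) * ‖u‖ ^ 2) with hG
  set H := ∫ u : V, ‖charFun μ u ^ m‖ with hH
  have hH0 : 0 ≤ H := integral_nonneg fun _ => norm_nonneg _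
  have hmint := (integrable_charFun_pow_of_decay hdecay hm).norm
  have hlarge : ∀ n : ℕ, 2 ≤ n → m ≤ n →
      ∫ u : V, ‖charFun μ ((√n)⁻¹ • u) ^ n - Real.exp (-‖u‖ ^ 2 / 2)‖ ≤
        (A * G + (q ^ m)⁻¹ * H * B) * (√n)⁻¹ := by
    intro n hn hmn
    have hn0 : (0 : ℝ) < n := by positivity
    have hn1 : (1 : ℝ) ≤ n := by exact_mod_cast (by omega : 1 ≤ n)
    have hs : 0 < √(n : ℝ) := Real.sqrt_pos.2 hn0
    have hs1 : 1 ≤ √(n : ℝ) := Real.one_le_sqrt.2 hn1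
    have i1 : Integrable (fun u : V => (√n)⁻¹ * (A * Real.exp (-(1 / 16) * ‖u‖ ^ 2))) :=
      ((integrable_rexp_neg_mul_sq_norm (by norm_num)).const_mul _).const_mul _
    have i2 : Integrable (fun u : V => q ^ (n - m) * ‖charFun μ ((√n)⁻¹ • u) ^ m‖) :=
      ((integrable_comp_smul_iff volume (fun u : V => ‖charFun μ u ^ m‖)
        (inv_ne_zero hs.ne')).2 hmint).const_mul _
    refine (integral_mono_of_nonneg (ae_of_all _ fun _ => norm_nonneg _) (i1.add i2)
      (ae_of_all _ (hbound n hn hmn))).trans ?_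
    rw [integral_add' i1 i2, integral_const_mul, integral_const_mul, integral_const_mul,
      Measure.integral_comp_inv_smul volume (fun u : V => ‖charFun μ u ^ m‖), ← hG, ← hH,
      abs_of_nonneg (by positivity), smul_eq_mul, add_mul]
    refine add_le_add (le_of_eq (by ring)) ?_
    have hqs : q ^ (n - m) = (q ^ m)⁻¹ * q ^ n := by
      rw [pow_sub₀ _ hq0.ne' hmn, mul_comm]
    have hsn : √(n : ℝ) ^ d ≤ (n : ℝ) ^ (d + 1) * (√n)⁻¹ := by
      rw [← div_eq_mul_inv, le_div_iff₀ hs, ← pow_succ]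
      gcongr
      rw [Real.sqrt_le_left hn0.le]
      nlinarith
    calc q ^ (n - m) * (√(n : ℝ) ^ d * H)
        ≤ (q ^ m)⁻¹ * q ^ n * ((n : ℝ) ^ (d + 1) * (√n)⁻¹ * H) := by rw [hqs]; gcongr
      _ = (q ^ m)⁻¹ * H * ((n : ℝ) ^ (d + 1) * q ^ n) * (√n)⁻¹ := by ring
      _ ≤ (q ^ m)⁻¹ * H * B * (√n)⁻¹ := by gcongr; exact hB n
  -- Only finitely many `n` fail `2 ≤ n ∧ m ≤ n`, all below `m + 2`; adding their values to the
  -- constant covers them.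
  set J : ℕ → ℝ := fun n =>
    √n * ∫ u : V, ‖charFun μ ((√n)⁻¹ • u) ^ n - Real.exp (-‖u‖ ^ 2 / 2)‖ with hJ
  have hJ0 : ∀ n, 0 ≤ J n := fun n =>
    mul_nonneg (Real.sqrt_nonneg _) (integral_nonneg fun _ => norm_nonneg _)
  refine ⟨|A * G + (q ^ m)⁻¹ * H * B| + ∑ n ∈ Finset.range (m + 2), J n,
    add_nonneg (abs_nonneg _) (Finset.sum_nonneg fun n _ => hJ0 n), fun n hn0 _ => ?_⟩
  have hs : 0 < √(n : ℝ) := Real.sqrt_pos.2 (by exact_mod_cast hn0)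
  by_cases hn : 2 ≤ n ∧ m ≤ n
  · refine (hlarge n hn.1 hn.2).trans ?_
    refine mul_le_mul_of_nonneg_right ?_ (by positivity)
    exact (le_abs_self _).trans
      (le_add_of_nonneg_right (Finset.sum_nonneg fun n _ => hJ0 n))
  · rw [← div_eq_mul_inv, le_div_iff₀ hs, mul_comm]
    have : J n ≤ ∑ n ∈ Finset.range (m + 2), J n :=
      Finset.single_le_sum (fun i _ => hJ0 i) (Finset.mem_range.2 (by omega))
    exact this.trans (le_add_of_nonneg_left (abs_nonneg _))

end CharFunEstimates

/-! ### Uniform moment bounds for the normalized sums. -/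

section Moments

/-- The term linear in `y` is kept exact because its expectation vanishes for centred independent
increments. All terms of higher degree in `y` are controlled by `|a|^m |y|^(2k-m) ≤ a^(2k) +
y^(2k)`, and their binomial coefficients sum to at most `2^(2k+2)`. -/
lemma add_pow_two_mul_add_two_le (a y : ℝ) (k : ℕ) :
    (a + y) ^ (2 * k + 2) ≤ a ^ (2 * k + 2) + (2 * k + 2) * (a ^ (2 * k + 1) * y) +
      2 ^ (2 * k + 2) * (a ^ (2 * k) * y ^ 2 + y ^ (2 * k + 2)) := by
  have hE : ∀ z : ℝ, |z| ^ (2 * k) = z ^ (2 * k) := fun z => (even_two_mul k).pow_abs z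
  set W := a ^ (2 * k) * y ^ 2 + y ^ (2 * k + 2) with hW
  have hW0 : 0 ≤ W := by
    rw [hW, ← hE, show y ^ (2 * k + 2) = |y| ^ (2 * k) * y ^ 2 by rw [hE]; ring]
    positivity
  have hterm : ∀ m ∈ Finset.range (2 * k + 1),
      a ^ m * y ^ (2 * k + 2 - m) * ((2 * k + 2).choose m : ℝ) ≤ W * (2 * k + 2).choose m := by
    intro m hm
    have hm' : m ≤ 2 * k := by have := Finset.mem_range.1 hm; omega
    gcongr
    have h1 : |a| ^ m * |y| ^ (2 * k - m) ≤ |a| ^ (2 * k) + |y| ^ (2 * k) := by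
      rcases le_total |a| |y| with h | h
      · calc |a| ^ m * |y| ^ (2 * k - m) ≤ |y| ^ m * |y| ^ (2 * k - m) := by gcongr
          _ = |y| ^ (2 * k) := by rw [← pow_add, Nat.add_sub_cancel' hm']
          _ ≤ _ := le_add_of_nonneg_left (by positivity)
      · calc |a| ^ m * |y| ^ (2 * k - m) ≤ |a| ^ m * |a| ^ (2 * k - m) := by gcongr
          _ = |a| ^ (2 * k) := by rw [← pow_add, Nat.add_sub_cancel' hm']
          _ ≤ _ := le_add_of_nonneg_right (by positivity)
    calc a ^ m * y ^ (2 * k + 2 - m) ≤ |a ^ m * y ^ (2 * k + 2 - m)| := le_abs_self _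
      _ = |a| ^ m * |y| ^ (2 * k - m) * y ^ 2 := by
        rw [abs_mul, abs_pow, abs_pow, show 2 * k + 2 - m = (2 * k - m) + 2 by omega, pow_add,
          sq_abs, mul_assoc]
      _ ≤ (|a| ^ (2 * k) + |y| ^ (2 * k)) * y ^ 2 := by gcongr
      _ = W := by rw [hE, hE, hW]; ring
  have hchoose : ∑ m ∈ Finset.range (2 * k + 1), ((2 * k + 2).choose m : ℝ) ≤ 2 ^ (2 * k + 2) := by
    have := Nat.sum_range_choose (2 * k + 2)
    calc ∑ m ∈ Finset.range (2 * k + 1), ((2 * k + 2).choose m : ℝ)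
        ≤ ∑ m ∈ Finset.range (2 * k + 2 + 1), ((2 * k + 2).choose m : ℝ) :=
          Finset.sum_le_sum_of_subset_of_nonneg (Finset.range_mono (by omega))
            fun _ _ _ => by positivity
      _ = 2 ^ (2 * k + 2) := by exact_mod_cast this
  rw [add_pow, Finset.sum_range_succ, Finset.sum_range_succ]
  have e1 : a ^ (2 * k + 1) * y ^ (2 * k + 2 - (2 * k + 1)) * ((2 * k + 2).choose (2 * k + 1) : ℝ) =
      (2 * k + 2) * (a ^ (2 * k + 1) * y) := by
    rw [show 2 * k + 2 - (2 * k + 1) = 1 by omega, Nat.choose_succ_self_right]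
    push_cast
    ring
  have e2 : a ^ (2 * k + 2) * y ^ (2 * k + 2 - (2 * k + 2)) *
      ((2 * k + 2).choose (2 * k + 2) : ℝ) = a ^ (2 * k + 2) := by simp
  rw [e1, e2]
  have := Finset.sum_le_sum hterm
  rw [← Finset.mul_sum] at this
  have := mul_le_mul_of_nonneg_left hchoose hW0
  linarith

lemma memLp_of_forall_integrable_norm_pow {Ω E : Type*} [MeasurableSpace Ω]
    {P : Measure Ω} [NormedAddCommGroup E] {Z : Ω → E}
    (hm : AEStronglyMeasurable Z P) (h : ∀ k : ℕ, Integrable (fun ω => ‖Z ω‖ ^ k) P) (p : ℕ) :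
    MemLp Z p P := by
  rcases eq_or_ne p 0 with rfl | hp
  · simpa using memLp_zero_iff_aestronglyMeasurable.2 hm
  · exact (integrable_norm_rpow_iff hm (by exact_mod_cast hp) (by simp)).1 (by simpa using h p)

variable {Ω : Type*} [MeasurableSpace Ω] {P : Measure Ω} [IsProbabilityMeasure P]

/-- Even moments of a sum of `n` centred i.i.d. real random variables grow like `n ^ k`. -/
theorem exists_integral_sum_pow_le {X : ℕ → Ω → ℝ} (hmeas : ∀ n, Measurable (X n))
    (hindep : iIndepFun X P) (hident : ∀ n, IdentDistrib (X n) (X 0) P P)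
    (hX : ∀ p : ℕ, MemLp (X 0) p P) (hmean : ∫ ω, X 0 ω ∂P = 0) (k : ℕ) :
    ∃ B : ℝ, 0 ≤ B ∧
      ∀ n : ℕ, ∫ ω, (∑ j ∈ Finset.Icc 1 n, X j ω) ^ (2 * k) ∂P ≤ B * (n : ℝ) ^ k := by
  have hXn : ∀ (n p : ℕ), MemLp (X n) p P := fun n p => (hident n).memLp_iff.2 (hX p)
  have hpow : ∀ {Z : Ω → ℝ}, (∀ p : ℕ, MemLp Z p P) → ∀ p : ℕ, Integrable (fun ω => Z ω ^ p) P := by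
    intro Z hZ p
    refine (hZ p).integrable_norm_pow'.mono' ((hZ p).1.pow p) (ae_of_all _ fun ω => ?_)
    rw [norm_pow]
  have hT : ∀ n p : ℕ, MemLp (fun ω => ∑ j ∈ Finset.Icc 1 n, X j ω) p P := fun n p =>
    memLp_finsetSum _ fun j _ => hXn j p
  have hXpow : ∀ n p : ℕ, ∫ ω, X n ω ^ p ∂P = ∫ ω, X 0 ω ^ p ∂P := fun n p =>
    ((hident n).comp (measurable_id.pow_const p)).integral_eq
  have hind : ∀ n a b : ℕ, IndepFun (fun ω => (∑ j ∈ Finset.Icc 1 n, X j ω) ^ a)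
      (fun ω => X (n + 1) ω ^ b) P := by
    intro n a b
    have h := hindep.indepFun_finsetSum_of_notMem hmeas (s := Finset.Icc 1 n) (i := n + 1)
      (by simp)
    have h2 := h.comp (measurable_id.pow_const a) (measurable_id.pow_const b)
    have e : (fun ω => (∑ j ∈ Finset.Icc 1 n, X j ω) ^ a) =
        (fun x => id x ^ a) ∘ ∑ j ∈ Finset.Icc 1 n, X j := by
      ext ω
      simp
    rw [e]
    exact h2
  have hint : ∀ n a b : ℕ, Integrable
      (fun ω => (∑ j ∈ Finset.Icc 1 n, X j ω) ^ a * X (n + 1) ω ^ b) P := fun n a b =>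
    (hind n a b).integrable_mul (hpow (hT n) a) (hpow (hXn _) b)
  have hprod : ∀ n a b : ℕ, ∫ ω, (∑ j ∈ Finset.Icc 1 n, X j ω) ^ a * X (n + 1) ω ^ b ∂P =
      (∫ ω, (∑ j ∈ Finset.Icc 1 n, X j ω) ^ a ∂P) * ∫ ω, X 0 ω ^ b ∂P := by
    intro n a b
    rw [← hXpow (n + 1) b]
    exact (hind n a b).integral_fun_mul_eq_mul_integral (hpow (hT n) a).1 (hpow (hXn _) b).1
  induction k with
  | zero => exact ⟨1, by norm_num, fun n => by simp⟩
  | succ k ih =>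
    obtain ⟨B, hB0, hB⟩ := ih
    set m₂ := ∫ ω, X 0 ω ^ 2 ∂P
    have hm₂ : 0 ≤ m₂ := integral_nonneg fun ω => by positivity
    set mk := ∫ ω, X 0 ω ^ (2 * k + 2) ∂P
    have hmk : 0 ≤ mk := integral_nonneg fun ω => (by
      have : Even (2 * k + 2) := ⟨k + 1, by ring⟩
      exact this.pow_nonneg _)
    -- Adding one summand raises the moment by at most `D (n+1)^k`, by the bound for exponent `2k`;
    -- summing over `n` gives `D n^(k+1)`.
    set D := 2 ^ (2 * k + 2) * (B * m₂ + mk) with hD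
    have hD0 : 0 ≤ D := by positivity
    refine ⟨D, hD0, fun n => ?_⟩
    rw [show 2 * (k + 1) = 2 * k + 2 by ring]
    induction n with
    | zero => simp
    | succ n ihn =>
      have i1 := hpow (hT n) (2 * k + 2)
      have i2 : Integrable
          (fun ω => (∑ j ∈ Finset.Icc 1 n, X j ω) ^ (2 * k + 1) * X (n + 1) ω) P := by
        simpa using hint n (2 * k + 1) 1
      have i3 := hint n (2 * k) 2
      have i4 := hpow (hXn (n + 1)) (2 * k + 2)
      have hmono : ∫ ω, (∑ j ∈ Finset.Icc 1 (n + 1), X j ω) ^ (2 * k + 2) ∂P ≤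
          ∫ ω, ((∑ j ∈ Finset.Icc 1 n, X j ω) ^ (2 * k + 2) +
            (2 * k + 2) * ((∑ j ∈ Finset.Icc 1 n, X j ω) ^ (2 * k + 1) * X (n + 1) ω) +
            2 ^ (2 * k + 2) * ((∑ j ∈ Finset.Icc 1 n, X j ω) ^ (2 * k) * X (n + 1) ω ^ 2 +
              X (n + 1) ω ^ (2 * k + 2))) ∂P := by
        refine integral_mono (hpow (hT (n + 1)) _)
          ((i1.add (i2.const_mul _)).add ((i3.add i4).const_mul _)) fun ω => ?_
        beta_reduce
        rw [Finset.sum_Icc_succ_top (by omega)]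
        exact add_pow_two_mul_add_two_le _ _ k
      have e1 : ∫ ω, (∑ j ∈ Finset.Icc 1 n, X j ω) ^ (2 * k + 1) * X (n + 1) ω ∂P = 0 := by
        have := hprod n (2 * k + 1) 1
        simpa [hmean] using this
      have hsplit : ∫ ω, ((∑ j ∈ Finset.Icc 1 n, X j ω) ^ (2 * k + 2) +
            (2 * k + 2) * ((∑ j ∈ Finset.Icc 1 n, X j ω) ^ (2 * k + 1) * X (n + 1) ω) +
            2 ^ (2 * k + 2) * ((∑ j ∈ Finset.Icc 1 n, X j ω) ^ (2 * k) * X (n + 1) ω ^ 2 +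
              X (n + 1) ω ^ (2 * k + 2))) ∂P =
          ∫ ω, (∑ j ∈ Finset.Icc 1 n, X j ω) ^ (2 * k + 2) ∂P +
            2 ^ (2 * k + 2) * ((∫ ω, (∑ j ∈ Finset.Icc 1 n, X j ω) ^ (2 * k) ∂P) * m₂ + mk) := by
        have i5 := i2.const_mul (2 * k + 2 : ℝ)
        have i34 : Integrable (fun ω => (∑ j ∈ Finset.Icc 1 n, X j ω) ^ (2 * k) * X (n + 1) ω ^ 2 +
              X (n + 1) ω ^ (2 * k + 2)) P := i3.add i4
        have i15 : Integrable (fun ω => (∑ j ∈ Finset.Icc 1 n, X j ω) ^ (2 * k + 2) +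
            (2 * k + 2) * ((∑ j ∈ Finset.Icc 1 n, X j ω) ^ (2 * k + 1) * X (n + 1) ω)) P :=
          i1.add i5
        rw [integral_add i15 (i34.const_mul _), integral_add i1 i5, integral_const_mul, e1,
          integral_const_mul, integral_add i3 i4, hprod, hXpow (n + 1), mul_zero, add_zero]
      rw [hsplit] at hmono
      have hn1 : (1 : ℝ) ≤ ((n : ℝ) + 1) ^ k := one_le_pow₀ (by linarith [n.cast_nonneg (α := ℝ)])
      have hnk : (n : ℝ) ^ k ≤ ((n : ℝ) + 1) ^ k := by gcongr; linarith
      have step : 2 ^ (2 * k + 2) * ((∫ ω, (∑ j ∈ Finset.Icc 1 n, X j ω) ^ (2 * k) ∂P) * m₂ + mk) ≤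
          D * ((n : ℝ) + 1) ^ k := by
        calc _ ≤ 2 ^ (2 * k + 2) * ((B * ((n : ℝ) + 1) ^ k) * m₂ + mk * ((n : ℝ) + 1) ^ k) := by
              gcongr
              · exact (hB n).trans (by gcongr)
              · exact le_mul_of_one_le_right hmk hn1
          _ = _ := by rw [hD]; ring
      calc _ ≤ D * (n : ℝ) ^ (k + 1) + D * ((n : ℝ) + 1) ^ k := by linarith
        _ ≤ D * (((n : ℝ) + 1) ^ k * n) + D * ((n : ℝ) + 1) ^ k := by
          rw [pow_succ]; gcongr
        _ = D * ((n + 1 : ℕ) : ℝ) ^ (k + 1) := by push_cast; ring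

/-- The power mean inequality for the squared coordinates; it reduces vector moments to scalar ones.
-/
lemma norm_pow_two_mul_le {d : ℕ} (x : EuclideanSpace ℝ (Fin d)) (k : ℕ) :
    ‖x‖ ^ (2 * (k + 1)) ≤ (d : ℝ) ^ k * ∑ i, x i ^ (2 * (k + 1)) := by
  rcases Nat.eq_zero_or_pos d with rfl | hd
  · simp [Subsingleton.elim x 0]
  · have h := pow_sum_div_card_le_sum_pow (s := Finset.univ) (f := fun i => x i ^ 2)
      (fun i _ => sq_nonneg _) k
    rw [Finset.card_univ, Fintype.card_fin, div_le_iff₀' (by positivity)] at h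
    rw [pow_mul, EuclideanSpace.real_norm_sq_eq]
    simpa only [pow_mul] using h

/-- The moments of the normalized sums are bounded uniformly in `n`. -/
theorem exists_integral_norm_normalizedSum_pow_le {d : ℕ} {Y : ℕ → Ω → EuclideanSpace ℝ (Fin d)}
    (hmeas : ∀ n, Measurable (Y n)) (hindep : iIndepFun Y P)
    (hident : ∀ n, IdentDistrib (Y n) (Y 0) P P)
    (hmoments : ∀ k : ℕ, Integrable (fun ω => ‖Y 0 ω‖ ^ k) P)
    (hmean : ∫ ω, Y 0 ω ∂P = 0) (k : ℕ) :
    ∃ M : ℝ, ∀ n : ℕ, 0 < n → Integrable (fun ω => ‖normalizedSum Y n ω‖ ^ (2 * (k + 1))) P ∧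
      ∫ ω, ‖normalizedSum Y n ω‖ ^ (2 * (k + 1)) ∂P ≤ M := by
  have hY : ∀ p : ℕ, MemLp (Y 0) p P :=
    memLp_of_forall_integrable_norm_pow (hmeas 0).aestronglyMeasurable hmoments
  have hYn : ∀ (n p : ℕ), MemLp (Y n) p P := fun n p => (hident n).memLp_iff.2 (hY p)
  have hproj : ∀ i : Fin d, Measurable (fun x : EuclideanSpace ℝ (Fin d) => x i) := fun i => by
    fun_prop
  have hYi : ∀ (i : Fin d) (n p : ℕ), MemLp (fun ω => Y n ω i) p P := fun i n p =>
    (hYn n p).mono ((hproj i).comp (hmeas n)).aestronglyMeasurable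
      (ae_of_all _ fun ω => PiLp.norm_apply_le _ i)
  have hcoord : ∀ i : Fin d, ∃ B : ℝ, 0 ≤ B ∧ ∀ n : ℕ,
      ∫ ω, (∑ j ∈ Finset.Icc 1 n, Y j ω i) ^ (2 * (k + 1)) ∂P ≤ B * (n : ℝ) ^ (k + 1) := by
    intro i
    refine exists_integral_sum_pow_le (X := fun n ω => Y n ω i)
      (fun n => (hproj i).comp (hmeas n)) (hindep.comp (fun _ x => x i) fun _ => hproj i)
      (fun n => (hident n).comp (hproj i)) (fun p => hYi i 0 p) ?_ (k + 1)
    have := (EuclideanSpace.proj (𝕜 := ℝ) i).integral_comp_comm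
      (memLp_one_iff_integrable.1 (by simpa using hY 1))
    rw [hmean] at this
    simpa using this
  choose B hB0 hB using hcoord
  refine ⟨(d : ℝ) ^ k * ∑ i, B i, fun n hn => ?_⟩
  have hn0 : (0 : ℝ) < n := by exact_mod_cast hn
  have hT : MemLp (fun ω => ∑ j ∈ Finset.Icc 1 n, Y j ω) (2 * (k + 1) : ℕ) P :=
    memLp_finsetSum _ fun j _ => hYn j _
  have hS : MemLp (normalizedSum Y n) (2 * (k + 1) : ℕ) P := hT.const_smul (√(n : ℝ))⁻¹
  refine ⟨hS.integrable_norm_pow', ?_⟩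
  have hTi : ∀ i, Integrable (fun ω => (∑ j ∈ Finset.Icc 1 n, Y j ω i) ^ (2 * (k + 1))) P := by
    intro i
    have hT : MemLp (fun ω => ∑ j ∈ Finset.Icc 1 n, Y j ω i) (2 * (k + 1) : ℕ) P :=
      memLp_finsetSum _ fun j _ => hYi i j _
    refine hT.integrable_norm_pow'.mono' (hT.1.pow _) (ae_of_all _ fun ω => ?_)
    rw [norm_pow]
  have hpt : ∀ ω, ‖normalizedSum Y n ω‖ ^ (2 * (k + 1)) ≤ ((n : ℝ) ^ (k + 1))⁻¹ *
      ((d : ℝ) ^ k * ∑ i, (∑ j ∈ Finset.Icc 1 n, Y j ω i) ^ (2 * (k + 1))) := by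
    intro ω
    rw [normalizedSum, norm_smul, mul_pow, Real.norm_of_nonneg (by positivity), inv_pow, pow_mul,
      Real.sq_sqrt hn0.le]
    gcongr
    refine (norm_pow_two_mul_le _ k).trans_eq ?_
    simp
  calc ∫ ω, ‖normalizedSum Y n ω‖ ^ (2 * (k + 1)) ∂P
      ≤ ∫ ω, ((n : ℝ) ^ (k + 1))⁻¹ *
          ((d : ℝ) ^ k * ∑ i, (∑ j ∈ Finset.Icc 1 n, Y j ω i) ^ (2 * (k + 1))) ∂P :=
        integral_mono hS.integrable_norm_pow'
          (((integrable_finsetSum _ fun i _ => hTi i).const_mul _).const_mul _) hpt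
    _ = ((n : ℝ) ^ (k + 1))⁻¹ * ((d : ℝ) ^ k *
          ∑ i, ∫ ω, (∑ j ∈ Finset.Icc 1 n, Y j ω i) ^ (2 * (k + 1)) ∂P) := by
        rw [integral_const_mul, integral_const_mul, integral_finsetSum _ fun i _ => hTi i]
    _ ≤ ((n : ℝ) ^ (k + 1))⁻¹ * ((d : ℝ) ^ k * ∑ i, B i * (n : ℝ) ^ (k + 1)) := by
        gcongr with i
        exact hB i n
    _ = (d : ℝ) ^ k * ∑ i, B i := by
        rw [← Finset.sum_mul]; field_simp

end Moments

/-! ### From uniform density bounds to total variation. -/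

section TotalVariation

lemma tvDist_le_two {E : Type*} [MeasurableSpace E] (μ ν : Measure E) [IsProbabilityMeasure μ]
    [IsProbabilityMeasure ν] : tvDist μ ν ≤ ENNReal.ofReal 2 := by
  refine iSup_le fun h => iSup_le fun _ => iSup_le fun hb => ENNReal.ofReal_le_ofReal ?_
  have key : ∀ ρ : Measure E, IsProbabilityMeasure ρ → |∫ x, h x ∂ρ| ≤ 1 := fun ρ _ => by
    simpa using norm_integral_le_of_norm_le_const (μ := ρ) (f := h) (C := 1) (ae_of_all _ hb)
  linarith [abs_sub (∫ x, h x ∂μ) (∫ x, h x ∂ν), key μ inferInstance, key ν inferInstance]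

variable {d : ℕ} {μ ν : Measure (EuclideanSpace ℝ (Fin d))} {f g : EuclideanSpace ℝ (Fin d) → ℝ}

lemma IsContinuousDensity.integral_eq (hf : IsContinuousDensity f μ)
    (h : EuclideanSpace ℝ (Fin d) → ℝ) : ∫ x, h x ∂μ = ∫ x, f x * h x := by
  rw [hf.eq_withDensity, integral_withDensity_eq_integral_toReal_smul
    hf.continuous.measurable.ennreal_ofReal (ae_of_all _ fun _ => by simp)]
  simp_rw [ENNReal.toReal_ofReal (hf.nonneg _), smul_eq_mul]

lemma IsContinuousDensity.integrable_mul (hf : IsContinuousDensity f μ)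
    {h : EuclideanSpace ℝ (Fin d) → ℝ} (hh : Integrable h μ) : Integrable (fun x => f x * h x) := by
  rw [hf.eq_withDensity, integrable_withDensity_iff_integrable_smul'
    hf.continuous.measurable.ennreal_ofReal (ae_of_all _ fun _ => by simp)] at hh
  simpa only [ENNReal.toReal_ofReal (hf.nonneg _), smul_eq_mul] using hh

/-- A uniform bound for the difference of two densities and moment bounds control the total
variation distance. -/
theorem tvDist_le_of_density_of_moment [IsProbabilityMeasure μ] [IsProbabilityMeasure ν]
    (hf : IsContinuousDensity f μ) (hg : IsContinuousDensity g ν) {δ : ℝ}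
    (hδ : ∀ x, |f x - g x| ≤ δ) {p : ℕ} {M : ℝ}
    (hμ : Integrable (fun x => ‖x‖ ^ p) μ) (hμM : ∫ x, ‖x‖ ^ p ∂μ ≤ M)
    (hν : Integrable (fun x => ‖x‖ ^ p) ν) (hνM : ∫ x, ‖x‖ ^ p ∂ν ≤ M) {R : ℝ} (hR : 0 < R) :
    tvDist μ ν ≤ ENNReal.ofReal
      (δ * (R ^ d * volume.real (Metric.ball (0 : EuclideanSpace ℝ (Fin d)) 1)) +
        2 * M / R ^ p) := by
  refine iSup_le fun h => iSup_le fun hm => iSup_le fun hb => ENNReal.ofReal_le_ofReal ?_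
  have hδ0 : 0 ≤ δ := (abs_nonneg _).trans (hδ 0)
  have hint : ∀ ρ : Measure (EuclideanSpace ℝ (Fin d)), IsProbabilityMeasure ρ → Integrable h ρ :=
    fun ρ _ => (integrable_const (1 : ℝ)).mono' hm.aestronglyMeasurable (ae_of_all _ hb)
  have jμ := hf.integrable_mul (hint μ inferInstance)
  have jν := hg.integrable_mul (hint ν inferInstance)
  have kμ := hf.integrable_mul hμ
  have kν := hg.integrable_mul hν
  set B := Metric.closedBall (0 : EuclideanSpace ℝ (Fin d)) R
  have hB : MeasurableSet B := Metric.isClosed_closedBall.measurableSet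
  have hBfin : volume B ≠ ∞ := measure_closedBall_lt_top.ne
  have iB : Integrable (B.indicator fun _ => δ) :=
    (integrable_indicator_iff hB).2 (integrableOn_const hBfin)
  -- Inside the ball the uniform bound `δ` is used. Outside, `|f - g| ≤ f + g` and `1 ≤ ‖x‖^p /
  -- R^p`, as in Markov's inequality.
  have hpt : ∀ x, ‖f x * h x - g x * h x‖ ≤
      B.indicator (fun _ => δ) x + (R ^ p)⁻¹ * (f x * ‖x‖ ^ p + g x * ‖x‖ ^ p) := by
    intro x
    have h1 : ‖f x * h x - g x * h x‖ ≤ |f x - g x| := by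
      rw [← sub_mul, norm_mul]
      exact mul_le_of_le_one_right (norm_nonneg _) (hb x)
    refine h1.trans ?_
    have hfx := hf.nonneg x
    have hgx := hg.nonneg x
    by_cases hx : x ∈ B
    · rw [Set.indicator_of_mem hx]
      exact (hδ x).trans (le_add_of_nonneg_right (by positivity))
    · rw [Set.indicator_of_notMem hx, zero_add]
      have hx' : R ≤ ‖x‖ := by
        simp only [B, Metric.mem_closedBall, dist_zero_right, not_le] at hx
        exact hx.le
      have h2 : 1 ≤ (R ^ p)⁻¹ * ‖x‖ ^ p := by
        rw [inv_mul_eq_div, one_le_div (by positivity)]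
        gcongr
      have h3 : |f x - g x| ≤ f x + g x := by
        rw [abs_le]; constructor <;> linarith
      calc |f x - g x| ≤ (f x + g x) * ((R ^ p)⁻¹ * ‖x‖ ^ p) :=
            h3.trans (le_mul_of_one_le_right (by positivity) h2)
        _ = _ := by ring
  have hvol : volume.real B =
      R ^ d * volume.real (Metric.ball (0 : EuclideanSpace ℝ (Fin d)) 1) := by
    rw [measureReal_def, Measure.addHaar_closedBall _ _ hR.le, ENNReal.toReal_mul,
      ENNReal.toReal_ofReal (by positivity), finrank_euclideanSpace_fin, measureReal_def]
  rw [hf.integral_eq, hg.integral_eq, ← integral_sub jμ jν]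
  have kadd : Integrable (fun x => f x * ‖x‖ ^ p + g x * ‖x‖ ^ p) := kμ.add kν
  refine (norm_integral_le_of_norm_le (iB.add (kadd.const_mul _)) (ae_of_all _ hpt)).trans ?_
  rw [integral_add' iB (kadd.const_mul _), integral_indicator hB, setIntegral_const,
    integral_const_mul, integral_add kμ kν, ← hf.integral_eq, ← hg.integral_eq, hvol, smul_eq_mul,
    mul_comm _ δ, inv_mul_eq_div]
  gcongr
  linarith

end TotalVariation

/-! ### The local limit theorem for normalized sums. -/

section LocalLimit

open scoped RealInnerProductSpace

variable {Ω : Type*} [MeasurableSpace Ω] {P : Measure Ω} {d : ℕ}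
  {Y : ℕ → Ω → EuclideanSpace ℝ (Fin d)}

lemma measurable_normalizedSum (hmeas : ∀ n, Measurable (Y n)) (n : ℕ) :
    Measurable (normalizedSum Y n) := by
  unfold normalizedSum
  fun_prop

lemma charFun_map_normalizedSum (hmeas : ∀ n, Measurable (Y n)) (hindep : iIndepFun Y P)
    (hident : ∀ n, IdentDistrib (Y n) (Y 0) P P) (n : ℕ) (t : EuclideanSpace ℝ (Fin d)) :
    charFun (P.map (normalizedSum Y n)) t = charFun (P.map (Y 0)) ((√(n : ℝ))⁻¹ • t) ^ n := by
  have h := charFun_map_smul_comp (μ := P) (f := fun ω => ∑ j ∈ Finset.Icc 1 n, Y j ω)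
    (Finset.measurable_sum _ fun j _ => hmeas j).aemeasurable (√(n : ℝ))⁻¹ t
  refine h.trans ?_
  rw [(hindep.restrict _).charFun_map_fun_finsetSum_eq_prod fun j _ => (hmeas j).aemeasurable]
  simp [fun i => (hident i).map_eq]

lemma integral_inner_map_eq_zero (hmeas : Measurable (Y 0)) (hint : Integrable (Y 0) P)
    (hmean : ∫ ω, Y 0 ω ∂P = 0) (t : EuclideanSpace ℝ (Fin d)) :
    ∫ x, ⟪x, t⟫ ∂(P.map (Y 0)) = 0 := by
  rw [integral_map hmeas.aemeasurable (by fun_prop)]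
  simp_rw [real_inner_comm t]
  rw [integral_inner hint, hmean, inner_zero_right]

/-- Bilinearity of covariance applied to `∑ i, t i * Y 0 ω i` leaves only the diagonal; the zero
mean identifies variance with second moment. -/
lemma integral_inner_sq_map_eq [IsProbabilityMeasure P] (hmeas : Measurable (Y 0))
    (hY : MemLp (Y 0) 2 P) (hmean : ∫ ω, Y 0 ω ∂P = 0)
    (hcov : ∀ i j : Fin d,
      covariance (fun ω => Y 0 ω i) (fun ω => Y 0 ω j) P = if i = j then 1 else 0)
    (t : EuclideanSpace ℝ (Fin d)) :
    ∫ x, ⟪x, t⟫ ^ 2 ∂(P.map (Y 0)) = ‖t‖ ^ 2 := by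
  have hYi : ∀ i : Fin d, MemLp (fun ω => Y 0 ω i) 2 P := fun i =>
    hY.mono (by fun_prop) (ae_of_all _ fun ω => PiLp.norm_apply_le _ i)
  have hmeani : ∫ ω, ⟪Y 0 ω, t⟫ ∂P = 0 := by
    rw [← integral_inner_map_eq_zero hmeas (hY.integrable one_le_two) hmean t,
      integral_map hmeas.aemeasurable (by fun_prop)]
  have hin : ∀ ω, ⟪Y 0 ω, t⟫ = ∑ i, t i * Y 0 ω i := fun ω => by
    simp [PiLp.inner_apply]
  have hsum : MemLp (fun ω => ⟪Y 0 ω, t⟫) 2 P := by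
    simp_rw [hin]
    exact memLp_finsetSum _ fun i _ => (hYi i).const_mul _
  have hc : covariance (fun ω => ⟪Y 0 ω, t⟫) (fun ω => ⟪Y 0 ω, t⟫) P = ‖t‖ ^ 2 := by
    simp_rw [hin]
    rw [covariance_fun_sum_fun_sum (fun i => (hYi i).const_mul _) (fun i => (hYi i).const_mul _)]
    simp_rw [covariance_const_mul_left, covariance_const_mul_right, hcov]
    rw [EuclideanSpace.real_norm_sq_eq]
    simp [sq]
  rw [covariance_eq_sub hsum hsum, hmeani] at hc
  rw [integral_map hmeas.aemeasurable (by fun_prop), ← hc]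
  simp [sq]

lemma isContinuousDensity_fourierDensity {μ : Measure (EuclideanSpace ℝ (Fin d))}
    [IsFiniteMeasure μ] (hμ : Integrable (charFun μ)) :
    IsContinuousDensity (fourierDensity μ) μ :=
  ⟨continuous_fourierDensity hμ, fourierDensity_nonneg hμ, eq_withDensity_fourierDensity hμ⟩

lemma integrable_charFun_normalizedSum [IsProbabilityMeasure P] (hmeas : ∀ n, Measurable (Y n))
    (hindep : iIndepFun Y P) (hident : ∀ n, IdentDistrib (Y n) (Y 0) P P) {α C : ℝ}
    (hchar : ∀ u : EuclideanSpace ℝ (Fin d),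
      ‖charFun (P.map (Y 0)) u‖ ≤ C * (1 + ‖u‖) ^ (-α)) {n : ℕ} (hn0 : 0 < n)
    (hn : (d : ℝ) < α * n) :
    Integrable (charFun (P.map (normalizedSum Y n))) := by
  have : IsProbabilityMeasure (P.map (Y 0)) :=
    Measure.isProbabilityMeasure_map (hmeas 0).aemeasurable
  have h := integrable_charFun_pow_of_decay hchar (n := n) (by simpa using hn)
  have hs : (√(n : ℝ))⁻¹ ≠ 0 := by positivity
  refine ((integrable_comp_smul_iff volume _ hs).2 h).congr (ae_of_all _ fun t => ?_)
  exact (charFun_map_normalizedSum hmeas hindep hident n t).symm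

/-- Local limit theorem with rate `n^(-1/2)`. -/
theorem exists_abs_fourierDensity_normalizedSum_sub_le [IsProbabilityMeasure P]
    (hmeas : ∀ n, Measurable (Y n))
    (hindep : iIndepFun Y P) (hident : ∀ n, IdentDistrib (Y n) (Y 0) P P)
    (hmoments : ∀ k : ℕ, Integrable (fun ω => ‖Y 0 ω‖ ^ k) P)
    (hmean : ∫ ω, Y 0 ω ∂P = 0)
    (hcov : ∀ i j : Fin d,
      covariance (fun ω => Y 0 ω i) (fun ω => Y 0 ω j) P = if i = j then 1 else 0)
    {α C : ℝ} (hα : 0 < α)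
    (hchar : ∀ u : EuclideanSpace ℝ (Fin d),
      ‖charFun (P.map (Y 0)) u‖ ≤ C * (1 + ‖u‖) ^ (-α)) :
    ∃ D : ℝ, 0 ≤ D ∧ ∀ n : ℕ, 0 < n → (d : ℝ) < α * n → ∀ x : EuclideanSpace ℝ (Fin d),
      |fourierDensity (P.map (normalizedSum Y n)) x - stdGaussianDensity x| ≤
        D * (√(n : ℝ))⁻¹ := by
  have : IsProbabilityMeasure (P.map (Y 0)) :=
    Measure.isProbabilityMeasure_map (hmeas 0).aemeasurable
  have hY := memLp_of_forall_integrable_norm_pow (hmeas 0).aestronglyMeasurable hmoments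
  have h3 : Integrable (fun x => ‖x‖ ^ 3) (P.map (Y 0)) :=
    (integrable_map_measure (by fun_prop) (hmeas 0).aemeasurable).2 (hmoments 3)
  obtain ⟨D, hD0, hD⟩ := exists_integral_norm_charFun_pow_sub_le h3
    (integral_inner_map_eq_zero (hmeas 0) (memLp_one_iff_integrable.1 (by simpa using hY 1)) hmean)
    (integral_inner_sq_map_eq (hmeas 0) (by simpa using hY 2) hmean hcov) hα hchar
  -- The factor `(2π)^(-d)` is the Jacobian of the substitution `u ↦ 2πu`.
  refine ⟨((2 * Real.pi) ^ d)⁻¹ * D, by positivity, fun n hn0 hn x => ?_⟩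
  rw [← fourierDensity_stdGaussian]
  refine (abs_fourierDensity_sub_le
    (integrable_charFun_normalizedSum hmeas hindep hident hchar hn0 hn)
    integrable_charFun_stdGaussian x).trans ?_
  rw [Measure.integral_comp_smul volume (fun u : EuclideanSpace ℝ (Fin d) =>
    ‖charFun (P.map (normalizedSum Y n)) u - charFun (stdGaussian _) u‖),
    finrank_euclideanSpace_fin, abs_of_nonneg (by positivity), smul_eq_mul, mul_assoc]
  gcongr
  simp_rw [charFun_map_normalizedSum hmeas hindep hident, charFun_stdGaussian]
  simpa using hD n hn0 (by simpa using hn)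

end LocalLimit

/-! ### Choice of the truncation radius and conclusion. -/

lemma isContinuousDensity_stdGaussianDensity (d : ℕ) :
    IsContinuousDensity stdGaussianDensity (stdGaussian (EuclideanSpace ℝ (Fin d))) := by
  have h := isContinuousDensity_fourierDensity (d := d) (μ := stdGaussian _)
    integrable_charFun_stdGaussian
  rwa [funext fourierDensity_stdGaussian] at h

theorem theorem4p2 {Ω : Type*} [MeasurableSpace Ω] (P : Measure Ω) [IsProbabilityMeasure P]
    (d : ℕ) (hd : 1 ≤ d) (Y : ℕ → Ω → EuclideanSpace ℝ (Fin d))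
    (hmeas : ∀ n, Measurable (Y n))
    (hindep : iIndepFun Y P)
    (hident : ∀ n, IdentDistrib (Y n) (Y 0) P P)
    (hmoments : ∀ k : ℕ, Integrable (fun ω => ‖Y 0 ω‖ ^ k) P)
    (hmean : ∫ ω, Y 0 ω ∂P = 0)
    (hcov : ∀ i j : Fin d,
      covariance (fun ω => Y 0 ω i) (fun ω => Y 0 ω j) P = if i = j then 1 else 0)
    (α C : ℝ) (hα : 0 < α)
    (hchar : ∀ u : EuclideanSpace ℝ (Fin d),
      ‖charFun (P.map (Y 0)) u‖ ≤ C * (1 + ‖u‖) ^ (-α)) :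
    (∀ ε : ℝ, 0 < ε → ∃ Cε : ℝ, ∀ n : ℕ, 2 ≤ n →
      tvDist (P.map (normalizedSum Y n)) (stdGaussian (EuclideanSpace ℝ (Fin d)))
        ≤ ENNReal.ofReal (Cε * (n : ℝ) ^ (-(1 / 2 : ℝ) + ε))) ∧
    ∃ f : ℕ → EuclideanSpace ℝ (Fin d) → ℝ,
      (∀ n : ℕ, (d : ℝ) < α * n → IsContinuousDensity (f n) (P.map (normalizedSum Y n))) ∧
      ∀ ε : ℝ, 0 < ε → ∃ Cε' : ℝ, ∀ n : ℕ, (d : ℝ) < α * n →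
        ∀ x : EuclideanSpace ℝ (Fin d),
          |f n x - stdGaussianDensity x| ≤ Cε' * (n : ℝ) ^ (-(1 / 2 : ℝ) + ε) := by
  obtain ⟨D, hD0, hD⟩ := exists_abs_fourierDensity_normalizedSum_sub_le hmeas hindep hident hmoments
    hmean hcov hα hchar
  have hd0 : (0 : ℝ) < d := by exact_mod_cast hd
  have hprob : ∀ n, IsProbabilityMeasure (P.map (normalizedSum Y n)) := fun n =>
    Measure.isProbabilityMeasure_map (measurable_normalizedSum hmeas n).aemeasurable
  have hpos : ∀ n : ℕ, (d : ℝ) < α * n → 0 < n := by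
    intro n hn
    rcases Nat.eq_zero_or_pos n with rfl | h
    · simp only [Nat.cast_zero, mul_zero] at hn
      linarith
    · exact h
  have hsqrt : ∀ n : ℕ, (√(n : ℝ))⁻¹ = (n : ℝ) ^ (-(1 / 2 : ℝ)) := fun n => by
    rw [Real.sqrt_eq_rpow, Real.rpow_neg (by positivity)]
  have hdens : ∀ n : ℕ, (d : ℝ) < α * n → IsContinuousDensity
      (fourierDensity (P.map (normalizedSum Y n))) (P.map (normalizedSum Y n)) := fun n hn =>
    isContinuousDensity_fourierDensity
      (integrable_charFun_normalizedSum hmeas hindep hident hchar (hpos n hn) hn)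
  refine ⟨fun ε hε => ?_, fun n => fourierDensity (P.map (normalizedSum Y n)), hdens,
    fun ε hε => ⟨D, fun n hn x => (hD n (hpos n hn) hn x).trans ?_⟩⟩
  -- With `R = n^(ε/d)` and moment order `p = 2(k+1) > d/ε`, the tail term `R^(-p)` is at most
  -- `n^(-1)`.
  · obtain ⟨k, hk⟩ := exists_nat_gt ((d : ℝ) / ε)
    rw [div_lt_iff₀ hε] at hk
    obtain ⟨M, hM⟩ := exists_integral_norm_normalizedSum_pow_le hmeas hindep hident hmoments hmean k
    set γ := stdGaussian (EuclideanSpace ℝ (Fin d)) with hγ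
    have hγint : Integrable (fun x => ‖x‖ ^ (2 * (k + 1))) γ :=
      (IsGaussian.memLp_id γ (2 * (k + 1) : ℕ) (ENNReal.natCast_ne_top _)).integrable_norm_pow'
    set M' := max M (∫ x, ‖x‖ ^ (2 * (k + 1)) ∂γ)
    have hM' : 0 ≤ M' := (integral_nonneg fun _ => by positivity).trans (le_max_right _ _)
    set v := volume.real (Metric.ball (0 : EuclideanSpace ℝ (Fin d)) 1)
    -- The three terms pay for the ball, for the tails, and for the finitely many `n ≤ d/α`, where
    -- total variation is at most `2 = 2n · n⁻¹ ≤ 2(d/α) n⁻¹`.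
    refine ⟨D * v + 2 * M' + 2 * (d / α), fun n hn => ?_⟩
    have hn0 : (0 : ℝ) < n := by positivity
    have hn1 : (1 : ℝ) ≤ n := by exact_mod_cast (by omega : 1 ≤ n)
    by_cases hnd : (d : ℝ) < α * n
    · have hS := measurable_normalizedSum hmeas n
      have hR : (0 : ℝ) < (n : ℝ) ^ (ε / d) := by positivity
      obtain ⟨hM1, hM2⟩ := hM n (by omega)
      refine (tvDist_le_of_density_of_moment (hdens n hnd)
        (isContinuousDensity_stdGaussianDensity d) (hD n (by omega) hnd) (p := 2 * (k + 1)) (M := M')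
        ((integrable_map_measure (by fun_prop) hS.aemeasurable).2 hM1) ?_ hγint
        (le_max_right _ _) hR).trans (ENNReal.ofReal_le_ofReal ?_)
      · rw [integral_map hS.aemeasurable (by fun_prop)]
        exact hM2.trans (le_max_left _ _)
      · have e1 : ((n : ℝ) ^ (ε / d)) ^ d = (n : ℝ) ^ ε := by
          rw [← Real.rpow_mul_natCast hn0.le, div_mul_cancel₀ _ hd0.ne']
        have e2 : (((n : ℝ) ^ (ε / d)) ^ (2 * (k + 1)))⁻¹ ≤ (n : ℝ) ^ (-(1 / 2 : ℝ) + ε) := by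
          rw [← Real.rpow_mul_natCast hn0.le, ← Real.rpow_neg hn0.le]
          refine Real.rpow_le_rpow_of_exponent_le hn1 ?_
          have : 1 ≤ ε / d * (2 * (k + 1) : ℕ) := by
            rw [div_mul_eq_mul_div, one_le_div hd0]
            push_cast
            nlinarith
          linarith
        rw [e1, hsqrt, div_eq_mul_inv]
        calc D * (n : ℝ) ^ (-(1 / 2 : ℝ)) * ((n : ℝ) ^ ε * v) +
              2 * M' * (((n : ℝ) ^ (ε / d)) ^ (2 * (k + 1)))⁻¹
            ≤ D * v * (n : ℝ) ^ (-(1 / 2 : ℝ) + ε) + 2 * M' * (n : ℝ) ^ (-(1 / 2 : ℝ) + ε) := by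
              refine add_le_add (le_of_eq ?_) (by gcongr)
              rw [Real.rpow_add hn0]; ring
          _ = (D * v + 2 * M') * (n : ℝ) ^ (-(1 / 2 : ℝ) + ε) := by ring
          _ ≤ _ := by
              refine mul_le_mul_of_nonneg_right ?_ (by positivity)
              exact le_add_of_nonneg_right (by positivity)
    · refine (tvDist_le_two _ _).trans (ENNReal.ofReal_le_ofReal ?_)
      have hv : 0 ≤ v := measureReal_nonneg
      have h1 : (n : ℝ)⁻¹ ≤ (n : ℝ) ^ (-(1 / 2 : ℝ) + ε) := by
        rw [← Real.rpow_neg_one]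
        exact Real.rpow_le_rpow_of_exponent_le hn1 (by linarith)
      have h2 : (n : ℝ) ≤ d / α := by
        rw [le_div_iff₀' hα]
        exact not_lt.1 hnd
      calc (2 : ℝ) = 2 * n * (n : ℝ)⁻¹ := by field_simp
        _ ≤ 2 * (d / α) * (n : ℝ) ^ (-(1 / 2 : ℝ) + ε) := by gcongr
        _ ≤ _ := by
          refine mul_le_mul_of_nonneg_right ?_ (by positivity)
          exact le_add_of_nonneg_left (by positivity)
  · rw [hsqrt]
    have hn1 : (1 : ℝ) ≤ n := by exact_mod_cast hpos n hn
    gcongr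
    linarith
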